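/- Let $\mathcal H_A,\mathcal H_B$ be finite-dimensional complex Hilbert spaces and $d_A=\dim\mathcal H_A$. A state $\rho=\rho^{AB}$ on $\mathcal H_A\otimes\mathcal H_B$ is a positive semidefinite operator of trace one; $\rho^A=\operatorname{tr}_B\rho$ and $\rho^B=\operatorname{tr}_A\rho$ are its reduced states (partial traces over $\mathcal H_B$ and $\mathcal H_A$ respectively). Let $\|X\|_1=\operatorname{tr}\sqrt{X^*X}$ be the trace norm, $S(\rho)=-\operatorname{tr}(\rho\log_2\rho)$ the von Neumann entropy (with $0\log_2 0=0$), $I(A:B)_\rho=S(\rho^A)+S(\rho^B)-S(\rho^{AB})$ the mutual information, $T(A:B)_\rho=\|\rho^{AB}-\rho^A\otimes\rho^B\|_1$ the trace distance correlation, and $h_b(x)=-x\log_2x-(1-x)\log_2(1-x)$ for $x\in[0,1]$ the binary entropy function. Let $\rho$ and $\sigma$ be states on $\mathcal H_A\otimes\mathcal H_B$ with $\delta=\|\rho^{AB}-\sigma^{AB}\|_1<1$. Then $$|I(A:B)_\rho-I(A:B)_\sigma|\le 6\,\delta\log_2 d_A+4\,h_b(\delta).$$ In particular, $\sigma^{AB}=\rho^A\otimes\rho^B$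 is a state with $I(A:B)_\sigma=0$ and $\|\rho^{AB}-\sigma^{AB}\|_1=T(A:B)_\rho$; hence, if $T(A:B)_\rho<1$, then $$I(A:B)_\rho\le 6\,T(A:B)_\rho\log_2 d_A+4\,h_b\big(T(A:B)_\rho\big).$$ -/

import Mathlib

open Matrix
open scoped Kronecker ComplexOrder

noncomputable section

namespace QInfo

variable {n A B : Type*} [Fintype n] [DecidableEq n] [Fintype A] [DecidableEq A]
  [Fintype B] [DecidableEq B]

/-- A state on the Hilbert space with orthonormal basis indexed by `n`: a positive semidefinite
matrix of trace one. -/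
def IsState (ρ : Matrix n n ℂ) : Prop := ρ.PosSemidef ∧ ρ.trace = 1

/-- The trace norm `‖X‖₁ = tr √(X* X)`. The square root is taken with the continuous functional
calculus of the Hermitian matrix `X* X`. -/
def traceNorm (X : Matrix n n ℂ) : ℝ := (cfc Real.sqrt (Xᴴ * X)).trace.re

/-- The von Neumann entropy `S(ρ) = - tr (ρ log₂ ρ)`. As `Real.logb 2 0 = 0`, zero eigenvalues
contribute `0`, the usual convention `0 log₂ 0 = 0`. -/
def entropy (ρ : Matrix n n ℂ) : ℝ := -(ρ * cfc (Real.logb 2) ρ).trace.re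

/-- The reduced matrix on the first factor (the second factor is traced out). -/
def reducedA (ρ : Matrix (A × B) (A × B) ℂ) : Matrix A A ℂ :=
  Matrix.of fun i j => ∑ k, ρ (i, k) (j, k)

/-- The reduced matrix on the second factor (the first factor is traced out). -/
def reducedB (ρ : Matrix (A × B) (A × B) ℂ) : Matrix B B ℂ :=
  Matrix.of fun i j => ∑ k, ρ (k, i) (k, j)

/-- The partial traces satisfy their characterization on elementary tensors. -/
theorem reducedA_kronecker {A B : Type*} [Fintype B] (x : Matrix A A ℂ) (y : Matrix B B ℂ) :
    reducedA (x ⊗ₖ y) = y.trace • x := by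
  ext i j
  simp [reducedA, Matrix.trace, Finset.mul_sum, mul_comm]

theorem reducedB_kronecker {A B : Type*} [Fintype A] (x : Matrix A A ℂ) (y : Matrix B B ℂ) :
    reducedB (x ⊗ₖ y) = x.trace • y := by
  ext i j
  simp [reducedB, Matrix.trace, Finset.sum_mul]

/-- The product `ρ_A ⊗ ρ_B` of the reduced matrices. -/
def productOfReduced (ρ : Matrix (A × B) (A × B) ℂ) : Matrix (A × B) (A × B) ℂ :=
  reducedA ρ ⊗ₖ reducedB ρ

/-- The mutual information `I(A:B)_ρ = S(ρ_A) + S(ρ_B) - S(ρ)`. -/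
def mutualInfo (ρ : Matrix (A × B) (A × B) ℂ) : ℝ :=
  entropy (reducedA ρ) + entropy (reducedB ρ) - entropy ρ

/-- The trace distance correlation `T(A:B)_ρ = ‖ρ - ρ_A ⊗ ρ_B‖₁`. -/
def traceDistCorr (ρ : Matrix (A × B) (A × B) ℂ) : ℝ :=
  traceNorm (ρ - productOfReduced ρ)

/-- The binary entropy function, with logarithms in base two. -/
def binaryEntropy (x : ℝ) : ℝ := -x * Real.logb 2 x - (1 - x) * Real.logb 2 (1 - x)

end QInfo

end

noncomputable section

namespace QInfo

open Filter Topology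

/-! Write `I(A:B) = S(A) - S(A|B)` with `S(A|B) = S(AB) - S(B)`. Both terms are concave in the
state, convex up to a binary entropy, and confined to intervals of length `log₂ d_A` and `2 log₂
d_A`. For such functionals the Alicki-Fannes-Winter argument (`sub_le_of_almost_affine`) applies:
with `ε = δ/2`, a common state is a mixture of `ρ` and an auxiliary state, and also of `σ` and
another one, with the same weights. Each term then changes by at most `ε` times its range plus `(1 +
ε) h_b(ε/(1 + ε))`, and `binaryEntropy_bound` absorbs the total into the stated constants.

The deep input is concavity of `S(A|B)`, equivalent to strong subadditivity. Since `S(A|B)_ρ =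
-D(ρ‖1 ⊗ ρ_B)`, it follows from joint convexity of relative entropy (`relEntropy_smul_add_le`).
There `D` is an integral over `t` of quantities that are suprema over `Z` of functionals affine in
`(ρ, σ)`, so convexity is immediate under the integral. The same representation shows that `D` is
antitone in `σ`; with `ρ ≤ d_A (1 ⊗ ρ_B)` and Klein's inequality this gives the range of `S(A|B)`.
-/

/-- `U` is unitary and `M = U diag(p) Uᴴ` with `p` real. -/
structure IsDiagonalization {n : Type*} [Fintype n] [DecidableEq n]
    (U : Matrix n n ℂ) (p : n → ℝ) (M : Matrix n n ℂ) : Prop where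
  mul_conj : U * Uᴴ = 1
  conj_mul : Uᴴ * U = 1
  eq : M = U * diagonal (fun i => (p i : ℂ)) * Uᴴ

/-! ### Spectral calculus in an arbitrary eigenbasis. -/

section Diagonalization

variable {n : Type*} [Fintype n] [DecidableEq n]

theorem isDiagonalization_eigenvalues {M : Matrix n n ℂ} (hM : M.IsHermitian) :
    IsDiagonalization (hM.eigenvectorUnitary : Matrix n n ℂ) hM.eigenvalues M := by
  refine ⟨?_, ?_, ?_⟩
  · exact Unitary.mul_star_self_of_mem hM.eigenvectorUnitary.2
  · exact Unitary.star_mul_self_of_mem hM.eigenvectorUnitary.2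
  · exact hM.spectral_theorem

theorem exists_isDiagonalization {M : Matrix n n ℂ} (hM : M.IsHermitian) :
    ∃ U p, IsDiagonalization U p M :=
  ⟨_, _, isDiagonalization_eigenvalues hM⟩

namespace IsDiagonalization

variable {U V M N : Matrix n n ℂ} {p q : n → ℝ}

theorem isHermitian (h : IsDiagonalization U p M) : M.IsHermitian := by
  rw [h.eq, IsHermitian, conjTranspose_mul, conjTranspose_mul, diagonal_conjTranspose,
    conjTranspose_conjTranspose, Matrix.mul_assoc]
  congr 3
  ext i
  simp

theorem conj_eq (h : IsDiagonalization U p M) :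
    Uᴴ * M * U = diagonal (fun i => (p i : ℂ)) := by
  rw [h.eq, ← Matrix.mul_assoc, ← Matrix.mul_assoc, h.conj_mul, Matrix.one_mul, Matrix.mul_assoc,
    h.conj_mul, Matrix.mul_one]

/-- The functional calculus does not depend on the eigenbasis: `Uᴴ * V` intertwines the two diagonal
matrices, so its `(i, j)` entry vanishes unless `p i = q j`, and hence it also intertwines their
images under `f`. -/
theorem cfc_eq (h : IsDiagonalization U p M) (f : ℝ → ℝ) :
    cfc f M = U * diagonal (fun i => (f (p i) : ℂ)) * Uᴴ := by
  have hM := h.isHermitian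
  have h' := isDiagonalization_eigenvalues hM
  set V : Matrix n n ℂ := (hM.eigenvectorUnitary : Matrix n n ℂ)
  set q := hM.eigenvalues
  have hc : cfc f M = V * diagonal (fun i => (f (q i) : ℂ)) * Vᴴ := hM.cfc_eq f
  have hW : diagonal (fun i => (p i : ℂ)) * (Uᴴ * V) =
      (Uᴴ * V) * diagonal (fun i => (q i : ℂ)) := by
    rw [← h.conj_eq, ← h'.conj_eq]
    calc Uᴴ * M * U * (Uᴴ * V) = Uᴴ * M * (U * Uᴴ) * V := by simp only [Matrix.mul_assoc]
      _ = Uᴴ * (V * Vᴴ) * M * V := by rw [h.mul_conj, h'.mul_conj]; simp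
      _ = _ := by simp only [Matrix.mul_assoc]
  have hW' : diagonal (fun i => (f (p i) : ℂ)) * (Uᴴ * V) =
      (Uᴴ * V) * diagonal (fun i => (f (q i) : ℂ)) := by
    ext i j
    have := congrFun (congrFun hW i) j
    rw [diagonal_mul, mul_diagonal] at this ⊢
    by_cases hij : (Uᴴ * V) i j = 0
    · simp [hij]
    · have hpq : p i = q j := by
        rw [mul_comm] at this
        exact_mod_cast mul_left_cancel₀ hij this
      rw [hpq, mul_comm]
  calc cfc f M = (U * Uᴴ) * V * diagonal (fun i => (f (q i) : ℂ)) * Vᴴ := by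
        rw [hc, h.mul_conj, Matrix.one_mul]
    _ = U * ((Uᴴ * V) * diagonal (fun i => (f (q i) : ℂ))) * Vᴴ := by
        simp only [Matrix.mul_assoc]
    _ = U * diagonal (fun i => (f (p i) : ℂ)) * Uᴴ * (V * Vᴴ) := by
        rw [← hW']; simp only [Matrix.mul_assoc]
    _ = _ := by rw [h'.mul_conj, Matrix.mul_one]

theorem cfc (h : IsDiagonalization U p M) (f : ℝ → ℝ) :
    IsDiagonalization U (fun i => f (p i)) (cfc f M) :=
  ⟨h.mul_conj, h.conj_mul, h.cfc_eq f⟩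

theorem eq_coe_trace (h : IsDiagonalization U p M) : M.trace = ((∑ i, p i : ℝ) : ℂ) := by
  rw [h.eq, trace_mul_comm, ← Matrix.mul_assoc, h.conj_mul, Matrix.one_mul]
  simp [Matrix.trace]

theorem posSemidef_iff (h : IsDiagonalization U p M) : M.PosSemidef ↔ ∀ i, 0 ≤ p i := by
  constructor
  · intro hM i
    have := (hM.conjTranspose_mul_mul_same U)
    rw [h.conj_eq, posSemidef_diagonal_iff] at this
    exact_mod_cast this i
  · intro hp
    rw [h.eq]
    refine PosSemidef.mul_mul_conjTranspose_same ?_ U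
    rw [posSemidef_diagonal_iff]
    intro i
    exact_mod_cast hp i

/-- The transition probabilities between the two eigenbases. -/
theorem trace_mul_re (h : IsDiagonalization U p M) (h' : IsDiagonalization V q N) :
    (M * N).trace.re = ∑ i, ∑ j, Complex.normSq ((Uᴴ * V) i j) * (p i * q j) := by
  have : (M * N).trace = (diagonal (fun i => (p i : ℂ)) * (Uᴴ * V) *
      diagonal (fun i => (q i : ℂ)) * (Uᴴ * V)ᴴ).trace := by
    rw [h.eq, h'.eq, conjTranspose_mul, conjTranspose_conjTranspose]
    simp only [Matrix.mul_assoc]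
    rw [trace_mul_comm]
    simp only [Matrix.mul_assoc]
  rw [this, Matrix.trace, Complex.re_sum]
  refine Finset.sum_congr rfl fun i _ => ?_
  rw [diag_apply, mul_apply, Complex.re_sum]
  refine Finset.sum_congr rfl fun j _ => ?_
  rw [mul_diagonal, diagonal_mul, conjTranspose_apply]
  have : (p i : ℂ) * (Uᴴ * V) i j * (q j : ℂ) * star ((Uᴴ * V) i j) =
      ((Complex.normSq ((Uᴴ * V) i j) * (p i * q j) : ℝ) : ℂ) := by
    push_cast
    rw [Complex.normSq_eq_conj_mul_self]
    simp only [RCLike.star_def]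
    ring
  rw [this, Complex.ofReal_re]

theorem sum_normSq_right (h : IsDiagonalization U p M) (h' : IsDiagonalization V q N) (i : n) :
    ∑ j, Complex.normSq ((Uᴴ * V) i j) = 1 := by
  have : (Uᴴ * V) * (Uᴴ * V)ᴴ = 1 := by
    rw [conjTranspose_mul, conjTranspose_conjTranspose, Matrix.mul_assoc, ← Matrix.mul_assoc V,
      h'.mul_conj, Matrix.one_mul, h.conj_mul]
  have h2 := congrFun (congrFun this i) i
  rw [mul_apply, one_apply_eq] at h2
  have h3 := congrArg Complex.re h2
  rw [Complex.re_sum, Complex.one_re] at h3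
  rw [← h3]
  refine Finset.sum_congr rfl fun j _ => ?_
  rw [conjTranspose_apply, RCLike.star_def, Complex.mul_conj, Complex.ofReal_re]

theorem sum_normSq_left (h : IsDiagonalization U p M) (h' : IsDiagonalization V q N) (j : n) :
    ∑ i, Complex.normSq ((Uᴴ * V) i j) = 1 := by
  rw [← h'.sum_normSq_right h j]
  refine Finset.sum_congr rfl fun i _ => ?_
  have : Vᴴ * U = (Uᴴ * V)ᴴ := by rw [conjTranspose_mul, conjTranspose_conjTranspose]
  rw [this, conjTranspose_apply, RCLike.star_def, Complex.normSq_conj]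

theorem mul_cfc_trace_re (h : IsDiagonalization U p M) (f : ℝ → ℝ) :
    (M * _root_.cfc f M).trace.re = ∑ i, p i * f (p i) := by
  rw [h.cfc_eq f]
  conv_lhs => rw [h.eq]
  have : U * diagonal (fun i => (p i : ℂ)) * Uᴴ * (U * diagonal (fun i => (f (p i) : ℂ)) * Uᴴ) =
      U * diagonal (fun i => ((p i * f (p i) : ℝ) : ℂ)) * Uᴴ := by
    calc _ = U * diagonal (fun i => (p i : ℂ)) * (Uᴴ * U) * diagonal (fun i => (f (p i) : ℂ)) * Uᴴ
        := by simp only [Matrix.mul_assoc]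
      _ = _ := by
        rw [h.conj_mul, Matrix.mul_one, Matrix.mul_assoc U, diagonal_mul_diagonal]
        simp
  rw [this, (IsDiagonalization.mk h.mul_conj h.conj_mul rfl).eq_coe_trace, Complex.ofReal_re]

theorem entropy_eq (h : IsDiagonalization U p M) :
    entropy M = -∑ i, p i * Real.logb 2 (p i) := by
  rw [entropy, h.mul_cfc_trace_re]

theorem smul (h : IsDiagonalization U p M) (c : ℝ) :
    IsDiagonalization U (fun i => c * p i) (c • M) := by
  refine ⟨h.mul_conj, h.conj_mul, ?_⟩
  rw [h.eq, ← Matrix.smul_mul, ← Matrix.mul_smul]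
  congr 2
  ext i j
  by_cases hij : i = j
  · subst hij; simp
  · simp [hij]

theorem traceNorm_eq (h : IsDiagonalization U p M) : traceNorm M = ∑ i, |p i| := by
  have h2 : IsDiagonalization U (fun i => p i ^ 2) (Mᴴ * M) := by
    refine ⟨h.mul_conj, h.conj_mul, ?_⟩
    rw [h.isHermitian.eq]
    conv_lhs => rw [h.eq]
    calc _ = U * diagonal (fun i => (p i : ℂ)) * (Uᴴ * U) * diagonal (fun i => (p i : ℂ)) * Uᴴ
        := by simp only [Matrix.mul_assoc]
      _ = _ := by
        rw [h.conj_mul, Matrix.mul_one, Matrix.mul_assoc U, diagonal_mul_diagonal]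
        simp [pow_two]
  rw [traceNorm, (h2.cfc _).eq_coe_trace, Complex.ofReal_re]
  simp [Real.sqrt_sq_eq_abs]

end IsDiagonalization

theorem IsDiagonalization.kronecker {m : Type*} [Fintype m] [DecidableEq m]
    {U M : Matrix n n ℂ} {V N : Matrix m m ℂ} {p : n → ℝ} {q : m → ℝ}
    (h : IsDiagonalization U p M) (h' : IsDiagonalization V q N) :
    IsDiagonalization (U ⊗ₖ V) (fun i => p i.1 * q i.2) (M ⊗ₖ N) := by
  refine ⟨?_, ?_, ?_⟩
  · rw [conjTranspose_kronecker, ← mul_kronecker_mul, h.mul_conj, h'.mul_conj, one_kronecker_one]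
  · rw [conjTranspose_kronecker, ← mul_kronecker_mul, h.conj_mul, h'.conj_mul, one_kronecker_one]
  · rw [conjTranspose_kronecker, h.eq, h'.eq, mul_kronecker_mul, mul_kronecker_mul,
      diagonal_kronecker_diagonal]
    simp

theorem isDiagonalization_one : IsDiagonalization (1 : Matrix n n ℂ) (fun _ => 1) 1 := by
  refine ⟨by simp, by simp, by simp⟩

end Diagonalization

/-! ### Variational and integral representation of the relative entropy. -/

section RelativeEntropy

variable {n : Type*} [Fintype n] [DecidableEq n]

/-- The quantum relative entropy `D(ρ‖σ) = tr ρ (log₂ ρ - log₂ σ)`. It is only meaningful when the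
kernel of `σ` is contained in the kernel of `ρ`. -/
def relEntropy (ρ σ : Matrix n n ℂ) : ℝ :=
  (ρ * cfc (Real.logb 2) ρ).trace.re - (ρ * cfc (Real.logb 2) σ).trace.re

/-- A functional, jointly affine in `(ρ, σ)`, whose supremum over `Z` is
`⟨ρ, (R_σ + t L_ρ)⁻¹ ρ⟩`, with `L` and `R` the left and right multiplications. -/
def resolventForm {n : Type*} [Fintype n] (t : ℝ) (Z ρ σ : Matrix n n ℂ) : ℝ :=
  2 * (ρ * Z).trace.re - (Z * σ * Zᴴ).trace.re - t * (ρ * (Z * Zᴴ)).trace.re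

/-- The value of the supremum of `resolventForm` in terms of eigenbases. -/
def resolventSum {n : Type*} [Fintype n] (U V : Matrix n n ℂ) (p q : n → ℝ) (t : ℝ) : ℝ :=
  ∑ i, ∑ j, Complex.normSq ((Uᴴ * V) i j) * (p i ^ 2 / (q j + t * p i))

theorem resolventForm_smul_add {n : Type*} [Fintype n] (t a b : ℝ) (Z ρ₁ ρ₂ σ₁ σ₂ : Matrix n n ℂ) :
    resolventForm t Z (a • ρ₁ + b • ρ₂) (a • σ₁ + b • σ₂) =
      a * resolventForm t Z ρ₁ σ₁ + b * resolventForm t Z ρ₂ σ₂ := by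
  simp only [resolventForm, Matrix.add_mul, Matrix.mul_add, Matrix.smul_mul, Matrix.mul_smul,
    trace_add, trace_smul, Complex.add_re, Complex.smul_re, smul_eq_mul]
  ring

theorem posSemidef_trace_re_nonneg {n : Type*} [Fintype n] {M : Matrix n n ℂ} (hM : M.PosSemidef) : 0 ≤ M.trace.re :=
  (Complex.nonneg_iff.mp hM.trace_nonneg).1

theorem resolventForm_anti {n : Type*} [Fintype n] {σ τ : Matrix n n ℂ} (h : (τ - σ).PosSemidef) (t : ℝ)
    (Z ρ : Matrix n n ℂ) : resolventForm t Z ρ τ ≤ resolventForm t Z ρ σ := by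
  have := posSemidef_trace_re_nonneg (h.mul_mul_conjTranspose_same Z)
  rw [Matrix.mul_sub, Matrix.sub_mul, trace_sub, Complex.sub_re] at this
  unfold resolventForm
  linarith

/-- Completing the square: after multiplication by `q + t * p` the gap is `|(q + t p) z - p w|²`. If
the denominator vanishes, then `p = q = 0` and both sides are zero. -/
theorem two_mul_re_sub_le {p q t : ℝ} (hp : 0 ≤ p) (hq : 0 ≤ q) (ht : 0 < t) (w z : ℂ) :
    2 * (p * (z * star w).re) - q * Complex.normSq z - t * (p * Complex.normSq z) ≤
      Complex.normSq w * (p ^ 2 / (q + t * p)) := by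
  rcases (add_nonneg hq (mul_nonneg ht.le hp)).eq_or_lt with h | h
  · have hp0 : p = 0 := by
      by_contra hne
      have : 0 < t * p := mul_pos ht (lt_of_le_of_ne hp (Ne.symm hne))
      linarith
    have hq0 : q = 0 := by rw [hp0] at h; linarith
    simp [hp0, hq0]
  · rw [← mul_div_assoc, le_div_iff₀ h]
    have h1 : (z * star w).re = z.re * w.re + z.im * w.im := by simp
    rw [h1, Complex.normSq_apply, Complex.normSq_apply]
    nlinarith [sq_nonneg ((q + t * p) * z.re - p * w.re), sq_nonneg ((q + t * p) * z.im - p * w.im)]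

theorem two_mul_re_sub_eq {p q t : ℝ} (hp : 0 ≤ p) (hq : 0 ≤ q) (ht : 0 < t) (w : ℂ) :
    2 * (p * (((p / (q + t * p) : ℝ) * w) * star w).re) -
      q * Complex.normSq ((p / (q + t * p) : ℝ) * w) -
      t * (p * Complex.normSq ((p / (q + t * p) : ℝ) * w)) =
      Complex.normSq w * (p ^ 2 / (q + t * p)) := by
  rcases (add_nonneg hq (mul_nonneg ht.le hp)).eq_or_lt with h | h
  · simp [← h]
  · have h1 : (((p / (q + t * p) : ℝ) * w) * star w).re =
        p / (q + t * p) * Complex.normSq w := by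
      rw [mul_assoc, RCLike.star_def, Complex.mul_conj, ← Complex.ofReal_mul, Complex.ofReal_re]
    have hd : (q + t * p) * (p / (q + t * p)) = p := mul_div_cancel₀ p h.ne'
    have h2 : p ^ 2 / (q + t * p) = p * (p / (q + t * p)) := by ring
    rw [h1, h2, Complex.normSq_mul, Complex.normSq_ofReal]
    generalize p / (q + t * p) = r at hd ⊢
    linear_combination -(r * Complex.normSq w) * hd

variable {U V ρ σ : Matrix n n ℂ} {p q : n → ℝ}

/-- Read in the two eigenbases, the form decouples into independent scalar quadratics in the entries
of `z`, so it can be maximized entry by entry. -/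
theorem resolventForm_eq (h : IsDiagonalization U p ρ) (h' : IsDiagonalization V q σ) (t : ℝ)
    (z : Matrix n n ℂ) :
    resolventForm t (U * z * Vᴴ) ρ σ = ∑ i, ∑ j, (2 * (p i * (z i j * star ((Uᴴ * V) i j)).re) -
      q j * Complex.normSq (z i j) - t * (p i * Complex.normSq (z i j))) := by
  have h1 : (ρ * (U * z * Vᴴ)).trace =
      (diagonal (fun i => (p i : ℂ)) * z * (Uᴴ * V)ᴴ).trace := by
    rw [h.eq, conjTranspose_mul, conjTranspose_conjTranspose]
    calc _ = (U * (diagonal (fun i => (p i : ℂ)) * ((Uᴴ * U) * z) * Vᴴ)).trace := by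
          simp only [Matrix.mul_assoc]
      _ = _ := by
          rw [h.conj_mul, Matrix.one_mul, trace_mul_comm]
          simp only [Matrix.mul_assoc]
  have h2 : ((U * z * Vᴴ) * σ * (U * z * Vᴴ)ᴴ).trace =
      (z * diagonal (fun i => (q i : ℂ)) * zᴴ).trace := by
    rw [h'.eq, conjTranspose_mul, conjTranspose_mul, conjTranspose_conjTranspose]
    calc _ = (U * (z * (Vᴴ * V) * diagonal (fun i => (q i : ℂ)) * (Vᴴ * V) * zᴴ * Uᴴ)).trace := by
          simp only [Matrix.mul_assoc]
      _ = (z * diagonal (fun i => (q i : ℂ)) * zᴴ * (Uᴴ * U)).trace := by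
          rw [h'.conj_mul, trace_mul_comm]
          simp only [Matrix.mul_assoc, Matrix.one_mul]
      _ = _ := by rw [h.conj_mul, Matrix.mul_one]
  have h3 : (ρ * ((U * z * Vᴴ) * (U * z * Vᴴ)ᴴ)).trace =
      (diagonal (fun i => (p i : ℂ)) * z * zᴴ).trace := by
    rw [h.eq, conjTranspose_mul, conjTranspose_mul, conjTranspose_conjTranspose]
    calc _ = (U * (diagonal (fun i => (p i : ℂ)) * (Uᴴ * U) * z * (Vᴴ * V) * zᴴ * Uᴴ)).trace := by
          simp only [Matrix.mul_assoc]
      _ = _ := by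
          rw [h.conj_mul, h'.conj_mul, trace_mul_comm]
          simp only [Matrix.mul_assoc, h.conj_mul, Matrix.mul_one]
  rw [resolventForm, h1, h2, h3]
  simp only [Finset.sum_sub_distrib, ← Finset.mul_sum]
  congr 1
  congr 1
  · congr 1
    rw [Matrix.trace, Complex.re_sum]
    refine Finset.sum_congr rfl fun i _ => ?_
    rw [diag_apply, mul_apply, Complex.re_sum]
    rw [Finset.mul_sum]
    refine Finset.sum_congr rfl fun j _ => ?_
    rw [diagonal_mul, conjTranspose_apply, mul_assoc, Complex.re_ofReal_mul]
  · rw [Matrix.trace, Complex.re_sum]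
    refine Finset.sum_congr rfl fun i _ => ?_
    rw [diag_apply, mul_apply, Complex.re_sum]
    refine Finset.sum_congr rfl fun j _ => ?_
    rw [mul_diagonal, conjTranspose_apply, mul_right_comm, RCLike.star_def, Complex.mul_conj,
      ← Complex.ofReal_mul, Complex.ofReal_re, mul_comm]
  · congr 1
    rw [Matrix.trace, Complex.re_sum]
    refine Finset.sum_congr rfl fun i _ => ?_
    rw [diag_apply, mul_apply, Complex.re_sum]
    rw [Finset.mul_sum]
    refine Finset.sum_congr rfl fun j _ => ?_
    rw [diagonal_mul, conjTranspose_apply, mul_assoc, RCLike.star_def, Complex.mul_conj,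
      Complex.re_ofReal_mul, Complex.ofReal_re]

theorem resolventForm_le (h : IsDiagonalization U p ρ) (h' : IsDiagonalization V q σ)
    (hp : ∀ i, 0 ≤ p i) (hq : ∀ i, 0 ≤ q i) {t : ℝ} (ht : 0 < t) (Z : Matrix n n ℂ) :
    resolventForm t Z ρ σ ≤ resolventSum U V p q t := by
  have hZ : Z = U * (Uᴴ * Z * V) * Vᴴ := by
    calc Z = (U * Uᴴ) * Z * (V * Vᴴ) := by rw [h.mul_conj, h'.mul_conj]; simp
      _ = _ := by simp only [Matrix.mul_assoc]
  rw [hZ, resolventForm_eq h h']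
  exact Finset.sum_le_sum fun i _ => Finset.sum_le_sum fun j _ =>
    two_mul_re_sub_le (hp i) (hq j) ht _ _

theorem exists_resolventForm_eq (h : IsDiagonalization U p ρ) (h' : IsDiagonalization V q σ)
    (hp : ∀ i, 0 ≤ p i) (hq : ∀ i, 0 ≤ q i) {t : ℝ} (ht : 0 < t) :
    ∃ Z, resolventForm t Z ρ σ = resolventSum U V p q t := by
  refine ⟨U * (Matrix.of fun i j => ((p i / (q j + t * p i) : ℝ) : ℂ) * (Uᴴ * V) i j) * Vᴴ, ?_⟩
  rw [resolventForm_eq h h']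
  exact Finset.sum_congr rfl fun i _ => Finset.sum_congr rfl fun j _ =>
    two_mul_re_sub_eq (hp i) (hq j) ht _

theorem relEntropy_eq (h : IsDiagonalization U p ρ) (h' : IsDiagonalization V q σ) :
    relEntropy ρ σ = ∑ i, ∑ j, Complex.normSq ((Uᴴ * V) i j) *
      (p i * (Real.logb 2 (p i) - Real.logb 2 (q j))) := by
  rw [relEntropy, h.mul_cfc_trace_re, h.trace_mul_re (h'.cfc _), ← Finset.sum_sub_distrib]
  refine Finset.sum_congr rfl fun i _ => ?_
  have : p i * Real.logb 2 (p i) =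
      ∑ j, Complex.normSq ((Uᴴ * V) i j) * (p i * Real.logb 2 (p i)) := by
    rw [← Finset.sum_mul, h.sum_normSq_right h' i, one_mul]
  rw [this, ← Finset.sum_sub_distrib]
  exact Finset.sum_congr rfl fun j _ => by ring

/-- If `ρ ≤ c σ` then eigenvectors of `σ` with eigenvalue zero are orthogonal to the range
of `ρ`. -/
theorem normSq_mul_eq_zero_or_pos (h : IsDiagonalization U p ρ) (h' : IsDiagonalization V q σ)
    (hp : ∀ i, 0 ≤ p i) (hq : ∀ i, 0 ≤ q i) {c : ℝ} (hc : (c • σ - ρ).PosSemidef) (i j : n) :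
    Complex.normSq ((Uᴴ * V) i j) * p i = 0 ∨ 0 < q j := by
  rcases (hq j).eq_or_lt with h0 | h0
  swap
  · exact Or.inr h0
  left
  have hVρ : (Vᴴ * ρ * V) j j = ((∑ k, Complex.normSq ((Uᴴ * V) k j) * p k : ℝ) : ℂ) := by
    have : Vᴴ * ρ * V = (Uᴴ * V)ᴴ * diagonal (fun i => (p i : ℂ)) * (Uᴴ * V) := by
      rw [h.eq, conjTranspose_mul, conjTranspose_conjTranspose]
      simp only [Matrix.mul_assoc]
    rw [this, mul_apply]
    push_cast
    refine Finset.sum_congr rfl fun k _ => ?_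
    rw [mul_diagonal, conjTranspose_apply, RCLike.star_def, Complex.normSq_eq_conj_mul_self]
    ring
  -- When `q j = 0`, the `j`-th diagonal entry of `c σ - ρ` in the basis `V` is minus a sum of
  -- nonnegative terms, yet nonnegative; so every term vanishes.
  have hd := (hc.conjTranspose_mul_mul_same V).diag_nonneg (i := j)
  rw [Matrix.mul_sub, Matrix.sub_mul, Matrix.mul_smul, Matrix.smul_mul, h'.conj_eq, Matrix.sub_apply,
    Matrix.smul_apply, diagonal_apply_eq, hVρ, ← h0] at hd
  simp only [Complex.ofReal_zero, smul_zero, zero_sub] at hd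
  rw [← Complex.ofReal_neg, Complex.zero_le_real] at hd
  have hnn : ∀ k ∈ Finset.univ, 0 ≤ Complex.normSq ((Uᴴ * V) k j) * p k := fun k _ =>
    mul_nonneg (Complex.normSq_nonneg _) (hp k)
  have hs := Finset.sum_nonneg hnn
  exact (Finset.sum_eq_zero_iff_of_nonneg hnn).mp (by linarith) i (Finset.mem_univ i)

theorem intervalIntegrable_resolvent {w p q : ℝ} (hp : 0 ≤ p) (hs : w * p = 0 ∨ 0 < q) {N : ℝ}
    (hN : 0 ≤ N) :
    IntervalIntegrable (fun t => w * (p ^ 2 / (q + t * p))) MeasureTheory.volume 0 N := by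
  rcases hs with h | h
  · have : (fun t => w * (p ^ 2 / (q + t * p))) = fun _ => 0 := by
      funext t
      rw [← mul_div_assoc, pow_two, ← mul_assoc, h, zero_mul, zero_div]
    rw [this]
    exact intervalIntegrable_const
  · apply ContinuousOn.intervalIntegrable
    intro t ht
    rw [Set.uIcc_of_le hN] at ht
    have : q + t * p ≠ 0 := (add_pos_of_pos_of_nonneg h (mul_nonneg ht.1 hp)).ne'
    exact ContinuousAt.continuousWithinAt (by fun_prop (disch := assumption))

theorem integral_resolvent {w p q : ℝ} (hp : 0 ≤ p) (hs : w * p = 0 ∨ 0 < q) {N : ℝ}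
    (hN : 0 ≤ N) :
    ∫ t in (0 : ℝ)..N, w * (p ^ 2 / (q + t * p)) =
      w * p * (Real.log (q + N * p) - Real.log q) := by
  rcases hs with h | h
  · have : (fun t => w * (p ^ 2 / (q + t * p))) = fun _ => 0 := by
      funext t
      rw [← mul_div_assoc, pow_two, ← mul_assoc, h, zero_mul, zero_div]
    rw [this, h]
    simp
  · rw [intervalIntegral.integral_eq_sub_of_hasDerivAt
      (f := fun t => w * p * Real.log (q + t * p)) ?_
      (intervalIntegrable_resolvent hp (Or.inr h) hN)]
    · simp; ring
    · intro t ht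
      rw [Set.uIcc_of_le hN] at ht
      have h0 : q + t * p ≠ 0 := (add_pos_of_pos_of_nonneg h (mul_nonneg ht.1 hp)).ne'
      have h1 : HasDerivAt (fun t => q + t * p) p t := by
        simpa using ((hasDerivAt_id t).mul_const p).const_add q
      exact ((h1.log h0).const_mul (w * p)).congr_deriv (by ring)

/-- The integral up to a cutoff `N` diverges like `log N`; subtracting `log (1 + N)` leaves a finite
limit. -/
theorem tendsto_log_add_mul_sub_log {p : ℝ} (hp : 0 < p) (q : ℝ) :
    Tendsto (fun N : ℝ => Real.log (q + N * p) - Real.log (1 + N)) atTop (𝓝 (Real.log p)) := by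
  have h1 : Tendsto (fun N : ℝ => (q - p) * (1 + N)⁻¹ + p) atTop (𝓝 p) := by
    have : Tendsto (fun N : ℝ => (1 + N)⁻¹) atTop (𝓝 0) :=
      tendsto_inv_atTop_zero.comp (tendsto_atTop_add_const_left _ _ tendsto_id)
    simpa using (this.const_mul (q - p)).add_const p
  have h2 := h1.log hp.ne'
  refine h2.congr' ?_
  filter_upwards [eventually_gt_atTop (0 : ℝ), eventually_gt_atTop (-q / p)] with N hN hNq
  have h3 : 0 < q + N * p := by
    rw [div_lt_iff₀ hp] at hNq
    linarith
  have h4 : (1 + N) ≠ 0 := by linarith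
  rw [← Real.log_div h3.ne' h4]
  congr 1
  field_simp
  ring

theorem intervalIntegrable_resolventSum {n : Type*} [Fintype n] {U V : Matrix n n ℂ} {p q : n → ℝ}
    (hp : ∀ i, 0 ≤ p i)
    (hs : ∀ i j, Complex.normSq ((Uᴴ * V) i j) * p i = 0 ∨ 0 < q j) {N : ℝ} (hN : 0 ≤ N) :
    IntervalIntegrable (resolventSum U V p q) MeasureTheory.volume 0 N := by
  have : resolventSum U V p q = ∑ i, ∑ j, fun t =>
      Complex.normSq ((Uᴴ * V) i j) * (p i ^ 2 / (q j + t * p i)) := by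
    funext t
    simp [resolventSum]
  rw [this]
  exact IntervalIntegrable.sum _ fun i _ => IntervalIntegrable.sum _ fun j _ =>
    intervalIntegrable_resolvent (hp i) (hs i j) hN

/-- The integral representation of the relative entropy, from
`-log x = ∫₀^∞ ((x + t)⁻¹ - (1 + t)⁻¹) dt`. -/
theorem tendsto_integral_resolventSum (h : IsDiagonalization U p ρ) (h' : IsDiagonalization V q σ)
    (hp : ∀ i, 0 ≤ p i)
    (hs : ∀ i j, Complex.normSq ((Uᴴ * V) i j) * p i = 0 ∨ 0 < q j) :
    Tendsto (fun N : ℝ => (∫ t in (0 : ℝ)..N, resolventSum U V p q t) -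
      Real.log (1 + N) * ρ.trace.re) atTop (𝓝 (relEntropy ρ σ * Real.log 2)) := by
  have hlim : Tendsto (fun N : ℝ => ∑ i, ∑ j, Complex.normSq ((Uᴴ * V) i j) * (p i *
      (Real.log (q j + N * p i) - Real.log (1 + N) - Real.log (q j)))) atTop
      (𝓝 (∑ i, ∑ j, Complex.normSq ((Uᴴ * V) i j) *
      (p i * (Real.log (p i) - Real.log (q j))))) := by
    refine tendsto_finsetSum _ fun i _ => tendsto_finsetSum _ fun j _ => ?_
    refine Tendsto.const_mul _ ?_
    rcases (hp i).eq_or_lt with h0 | h0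
    · simp [← h0]
    · exact Tendsto.const_mul _ ((tendsto_log_add_mul_sub_log h0 _).sub_const _)
  have hD : relEntropy ρ σ * Real.log 2 = ∑ i, ∑ j, Complex.normSq ((Uᴴ * V) i j) *
      (p i * (Real.log (p i) - Real.log (q j))) := by
    rw [relEntropy_eq h h', Finset.sum_mul]
    refine Finset.sum_congr rfl fun i _ => ?_
    rw [Finset.sum_mul]
    refine Finset.sum_congr rfl fun j _ => ?_
    have : Real.log 2 ≠ 0 := (Real.log_pos (by norm_num)).ne'
    simp only [Real.logb]
    field_simp
  rw [hD]
  refine hlim.congr' ?_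
  filter_upwards [eventually_ge_atTop (0 : ℝ)] with N hN
  have hint : ∫ t in (0 : ℝ)..N, resolventSum U V p q t = ∑ i, ∑ j,
      Complex.normSq ((Uᴴ * V) i j) * p i * (Real.log (q j + N * p i) - Real.log (q j)) := by
    unfold resolventSum
    rw [intervalIntegral.integral_finsetSum]
    · refine Finset.sum_congr rfl fun i _ => ?_
      rw [intervalIntegral.integral_finsetSum]
      · exact Finset.sum_congr rfl fun j _ => integral_resolvent (hp i) (hs i j) hN
      · exact fun j _ => intervalIntegrable_resolvent (hp i) (hs i j) hN
    · intro i _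
      have : (fun t => ∑ j, Complex.normSq ((Uᴴ * V) i j) * (p i ^ 2 / (q j + t * p i))) =
          ∑ j, fun t => Complex.normSq ((Uᴴ * V) i j) * (p i ^ 2 / (q j + t * p i)) := by
        funext t
        simp
      rw [this]
      exact IntervalIntegrable.sum _ fun j _ => intervalIntegrable_resolvent (hp i) (hs i j) hN
  -- Rows of the transition matrix sum to one, which spreads the counterterm over all pairs `(i,
  -- j)`.
  have htr : Real.log (1 + N) * ρ.trace.re =
      ∑ i, ∑ j, Complex.normSq ((Uᴴ * V) i j) * p i * Real.log (1 + N) := by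
    rw [h.eq_coe_trace, Complex.ofReal_re, Finset.mul_sum]
    refine Finset.sum_congr rfl fun i _ => ?_
    rw [← Finset.sum_mul, ← Finset.sum_mul, h.sum_normSq_right h' i]
    ring
  rw [hint, htr, ← Finset.sum_sub_distrib]
  refine Finset.sum_congr rfl fun i _ => ?_
  rw [← Finset.sum_sub_distrib]
  exact Finset.sum_congr rfl fun j _ => by ring

end RelativeEntropy

/-! ### Convexity, monotonicity and bounds for relative entropy and entropy. -/

section RelativeEntropyInequalities

variable {n : Type*} [Fintype n] [DecidableEq n] {ρ σ τ ρ₁ ρ₂ σ₁ σ₂ : Matrix n n ℂ}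

/-- Joint convexity of the relative entropy (in homogeneous form). -/
theorem relEntropy_smul_add_le (hρ₁ : ρ₁.PosSemidef) (hρ₂ : ρ₂.PosSemidef)
    (hσ₁ : σ₁.PosSemidef) (hσ₂ : σ₂.PosSemidef) {c : ℝ} (h₁ : (c • σ₁ - ρ₁).PosSemidef)
    (h₂ : (c • σ₂ - ρ₂).PosSemidef) {a b : ℝ} (ha : 0 ≤ a) (hb : 0 ≤ b) :
    relEntropy (a • ρ₁ + b • ρ₂) (a • σ₁ + b • σ₂) ≤
      a * relEntropy ρ₁ σ₁ + b * relEntropy ρ₂ σ₂ := by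
  have hρ : (a • ρ₁ + b • ρ₂).PosSemidef := (hρ₁.smul ha).add (hρ₂.smul hb)
  have hσ : (a • σ₁ + b • σ₂).PosSemidef := (hσ₁.smul ha).add (hσ₂.smul hb)
  have hc : (c • (a • σ₁ + b • σ₂) - (a • ρ₁ + b • ρ₂)).PosSemidef := by
    have : c • (a • σ₁ + b • σ₂) - (a • ρ₁ + b • ρ₂) =
        a • (c • σ₁ - ρ₁) + b • (c • σ₂ - ρ₂) := by module
    rw [this]
    exact (h₁.smul ha).add (h₂.smul hb)
  obtain ⟨U₁, p₁, hU₁⟩ := exists_isDiagonalization hρ₁.isHermitian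
  obtain ⟨U₂, p₂, hU₂⟩ := exists_isDiagonalization hρ₂.isHermitian
  obtain ⟨V₁, q₁, hV₁⟩ := exists_isDiagonalization hσ₁.isHermitian
  obtain ⟨V₂, q₂, hV₂⟩ := exists_isDiagonalization hσ₂.isHermitian
  obtain ⟨U, p, hU⟩ := exists_isDiagonalization hρ.isHermitian
  obtain ⟨V, q, hV⟩ := exists_isDiagonalization hσ.isHermitian
  have hp₁ := hU₁.posSemidef_iff.mp hρ₁
  have hp₂ := hU₂.posSemidef_iff.mp hρ₂
  have hq₁ := hV₁.posSemidef_iff.mp hσ₁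
  have hq₂ := hV₂.posSemidef_iff.mp hσ₂
  have hp := hU.posSemidef_iff.mp hρ
  have hq := hV.posSemidef_iff.mp hσ
  have s₁ := normSq_mul_eq_zero_or_pos hU₁ hV₁ hp₁ hq₁ h₁
  have s₂ := normSq_mul_eq_zero_or_pos hU₂ hV₂ hp₂ hq₂ h₂
  have s := normSq_mul_eq_zero_or_pos hU hV hp hq hc
  have t₁ := tendsto_integral_resolventSum hU₁ hV₁ hp₁ s₁
  have t₂ := tendsto_integral_resolventSum hU₂ hV₂ hp₂ s₂
  have t := tendsto_integral_resolventSum hU hV hp s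
  have hlog : 0 < Real.log 2 := Real.log_pos (by norm_num)
  refine le_of_mul_le_mul_right ?_ hlog
  rw [add_mul, mul_assoc, mul_assoc]
  refine le_of_tendsto_of_tendsto t ((t₁.const_mul a).add (t₂.const_mul b)) ?_
  filter_upwards [eventually_ge_atTop (0 : ℝ)] with N hN
  have i₁ := intervalIntegrable_resolventSum hp₁ s₁ hN
  have i₂ := intervalIntegrable_resolventSum hp₂ s₂ hN
  have i := intervalIntegrable_resolventSum hp s hN
  have key : ∫ t in (0 : ℝ)..N, resolventSum U V p q t ≤
      ∫ t in (0 : ℝ)..N, (a * resolventSum U₁ V₁ p₁ q₁ t + b * resolventSum U₂ V₂ p₂ q₂ t) := by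
    refine intervalIntegral.integral_mono_on_of_le_Ioo hN i
      ((i₁.const_mul a).add (i₂.const_mul b)) fun t ht => ?_
    -- The `Z` optimal for the mixture is only a competitor for each component, and the form is
    -- affine: a supremum of affine functionals is convex.
    obtain ⟨Z, hZ⟩ := exists_resolventForm_eq hU hV hp hq ht.1
    rw [← hZ, resolventForm_smul_add]
    exact add_le_add
      (mul_le_mul_of_nonneg_left (resolventForm_le hU₁ hV₁ hp₁ hq₁ ht.1 Z) ha)
      (mul_le_mul_of_nonneg_left (resolventForm_le hU₂ hV₂ hp₂ hq₂ ht.1 Z) hb)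
  rw [intervalIntegral.integral_add (i₁.const_mul a) (i₂.const_mul b),
    intervalIntegral.integral_const_mul, intervalIntegral.integral_const_mul] at key
  rw [trace_add, trace_smul, trace_smul, Complex.add_re, Complex.smul_re, Complex.smul_re,
    smul_eq_mul, smul_eq_mul]
  linarith

/-- The relative entropy is antitone in its second argument. -/
theorem relEntropy_anti (hρ : ρ.PosSemidef) (hτ : τ.PosSemidef) (hτσ : (σ - τ).PosSemidef) {c : ℝ}
    (hc : 0 ≤ c) (h : (c • τ - ρ).PosSemidef) : relEntropy ρ σ ≤ relEntropy ρ τ := by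
  have hσ : σ.PosSemidef := by
    have := hτ.add hτσ
    rwa [add_sub_cancel] at this
  have h' : (c • σ - ρ).PosSemidef := by
    have : c • σ - ρ = c • (σ - τ) + (c • τ - ρ) := by module
    rw [this]
    exact (hτσ.smul hc).add h
  obtain ⟨U, p, hU⟩ := exists_isDiagonalization hρ.isHermitian
  obtain ⟨V, q, hV⟩ := exists_isDiagonalization hσ.isHermitian
  obtain ⟨W, r, hW⟩ := exists_isDiagonalization hτ.isHermitian
  have hp := hU.posSemidef_iff.mp hρ
  have hq := hV.posSemidef_iff.mp hσ
  have hr := hW.posSemidef_iff.mp hτ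
  have s := normSq_mul_eq_zero_or_pos hU hV hp hq h'
  have s' := normSq_mul_eq_zero_or_pos hU hW hp hr h
  have hlog : 0 < Real.log 2 := Real.log_pos (by norm_num)
  refine le_of_mul_le_mul_right ?_ hlog
  refine le_of_tendsto_of_tendsto (tendsto_integral_resolventSum hU hV hp s)
    (tendsto_integral_resolventSum hU hW hp s') ?_
  filter_upwards [eventually_ge_atTop (0 : ℝ)] with N hN
  refine sub_le_sub_right ?_ _
  refine intervalIntegral.integral_mono_on_of_le_Ioo hN (intervalIntegrable_resolventSum hp s hN)
    (intervalIntegrable_resolventSum hp s' hN) fun t ht => ?_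
  obtain ⟨Z, hZ⟩ := exists_resolventForm_eq hU hV hp hq ht.1
  rw [← hZ]
  exact (resolventForm_anti hτσ t Z ρ).trans (resolventForm_le hU hW hp hr ht.1 Z)

theorem relEntropy_smul_self (hρ : ρ.PosSemidef) {c : ℝ} (hc : 0 < c) :
    relEntropy ρ (c⁻¹ • ρ) = ρ.trace.re * Real.logb 2 c := by
  obtain ⟨U, p, hU⟩ := exists_isDiagonalization hρ.isHermitian
  have h1 : cfc (Real.logb 2) (c⁻¹ • ρ) = cfc (fun x => Real.logb 2 (c⁻¹ * x)) ρ := by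
    rw [(hU.smul c⁻¹).cfc_eq, hU.cfc_eq]
  rw [relEntropy, h1, hU.mul_cfc_trace_re, hU.mul_cfc_trace_re, hU.eq_coe_trace,
    Complex.ofReal_re, ← Finset.sum_sub_distrib, Finset.sum_mul]
  refine Finset.sum_congr rfl fun i _ => ?_
  by_cases hi : p i = 0
  · simp [hi]
  · rw [Real.logb_mul (inv_ne_zero hc.ne') hi, Real.logb_inv]
    ring

/-- If `ρ ≤ c σ` then `D(ρ‖σ) ≤ log₂ c`. -/
theorem relEntropy_le_logb (hρ : IsState ρ) {c : ℝ} (hc : 0 < c)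
    (h : (c • σ - ρ).PosSemidef) : relEntropy ρ σ ≤ Real.logb 2 c := by
  have h1 : (σ - c⁻¹ • ρ).PosSemidef := by
    have : σ - c⁻¹ • ρ = c⁻¹ • (c • σ - ρ) := by
      rw [smul_sub, smul_smul, inv_mul_cancel₀ hc.ne', one_smul]
    rw [this]
    exact h.smul (inv_nonneg.mpr hc.le)
  have h2 : (c • (c⁻¹ • ρ) - ρ).PosSemidef := by
    rw [smul_smul, mul_inv_cancel₀ hc.ne', one_smul, sub_self]
    exact PosSemidef.zero
  have := relEntropy_anti hρ.1 (hρ.1.smul (inv_nonneg.mpr hc.le)) h1 hc.le h2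
  rwa [relEntropy_smul_self hρ.1 hc, hρ.2, Complex.one_re, one_mul] at this

/-- Klein's inequality, for a second argument of trace `d`. -/
theorem neg_logb_le_relEntropy (hρ : IsState ρ) (hσ : σ.PosSemidef) {c : ℝ}
    (h : (c • σ - ρ).PosSemidef) {d : ℝ} (hd : 0 < d) (hσd : σ.trace.re = d) :
    -Real.logb 2 d ≤ relEntropy ρ σ := by
  obtain ⟨U, p, hU⟩ := exists_isDiagonalization hρ.1.isHermitian
  obtain ⟨V, q, hV⟩ := exists_isDiagonalization hσ.isHermitian
  have hp := hU.posSemidef_iff.mp hρ.1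
  have hq := hV.posSemidef_iff.mp hσ
  have s := normSq_mul_eq_zero_or_pos hU hV hp hq h
  have hlog : 0 < Real.log 2 := Real.log_pos (by norm_num)
  have hp1 : ∑ i, p i = 1 := by
    have := hρ.2
    rw [hU.eq_coe_trace] at this
    exact_mod_cast this
  have hq1 : ∑ j, q j = d := by
    rw [← hσd, hV.eq_coe_trace, Complex.ofReal_re]
  -- Termwise this is `log x ≤ x - 1` at `x = q j / (d * p i)`; the left side is then summed using
  -- double stochasticity of the transition probabilities.
  have key : ∑ i, ∑ j, Complex.normSq ((Uᴴ * V) i j) * ((p i - q j / d) - p i * Real.log d) ≤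
      relEntropy ρ σ * Real.log 2 := by
    rw [relEntropy_eq hU hV, Finset.sum_mul]
    refine Finset.sum_le_sum fun i _ => ?_
    rw [Finset.sum_mul]
    refine Finset.sum_le_sum fun j _ => ?_
    have hw := Complex.normSq_nonneg ((Uᴴ * V) i j)
    have e : Complex.normSq ((Uᴴ * V) i j) *
        (p i * (Real.logb 2 (p i) - Real.logb 2 (q j))) * Real.log 2 =
        Complex.normSq ((Uᴴ * V) i j) * (p i * (Real.log (p i) - Real.log (q j))) := by
      simp only [Real.logb]
      field_simp
    rw [e]
    rcases (hp i).eq_or_lt with hi | hi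
    · rw [← hi]
      have : 0 ≤ q j / d := div_nonneg (hq j) hd.le
      nlinarith
    rcases s i j with h0 | h0
    · have : Complex.normSq ((Uᴴ * V) i j) = 0 := by
        rcases mul_eq_zero.mp h0 with h0 | h0
        · exact h0
        · exact absurd h0 hi.ne'
      simp [this]
    · refine mul_le_mul_of_nonneg_left ?_ hw
      have h1 := Real.log_le_sub_one_of_pos (x := q j / (d * p i)) (by positivity)
      rw [Real.log_div h0.ne' (by positivity), Real.log_mul hd.ne' hi.ne'] at h1
      have h2 := mul_le_mul_of_nonneg_left h1 hi.le
      have h3 : p i * (q j / (d * p i) - 1) = q j / d - p i := by field_simp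
      rw [h3] at h2
      linarith
  have lhs : ∑ i, ∑ j, Complex.normSq ((Uᴴ * V) i j) * ((p i - q j / d) - p i * Real.log d) =
      -Real.log d := by
    have e1 : ∑ i, ∑ j, Complex.normSq ((Uᴴ * V) i j) * (p i * (1 - Real.log d)) =
        1 - Real.log d := by
      simp only [← Finset.sum_mul, hU.sum_normSq_right hV, one_mul, hp1]
    have e2 : ∑ i, ∑ j, Complex.normSq ((Uᴴ * V) i j) * (q j / d) = 1 := by
      rw [Finset.sum_comm]
      simp only [← Finset.sum_mul, hU.sum_normSq_left hV, one_mul]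
      rw [← Finset.sum_div, hq1, div_self hd.ne']
    have e3 : ∑ i, ∑ j, Complex.normSq ((Uᴴ * V) i j) * ((p i - q j / d) - p i * Real.log d) =
        ∑ i, ∑ j, Complex.normSq ((Uᴴ * V) i j) * (p i * (1 - Real.log d)) -
          ∑ i, ∑ j, Complex.normSq ((Uᴴ * V) i j) * (q j / d) := by
      rw [← Finset.sum_sub_distrib]
      refine Finset.sum_congr rfl fun i _ => ?_
      rw [← Finset.sum_sub_distrib]
      exact Finset.sum_congr rfl fun j _ => by ring
    rw [e3, e1, e2]
    ring
  rw [lhs] at key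
  rw [Real.logb, ← neg_div, div_le_iff₀ hlog]
  exact key

theorem relEntropy_nonneg (hρ : IsState ρ) (hσ : IsState σ) {c : ℝ}
    (h : (c • σ - ρ).PosSemidef) : 0 ≤ relEntropy ρ σ := by
  have := neg_logb_le_relEntropy hρ hσ.1 h one_pos (by rw [hσ.2, Complex.one_re])
  simpa using this

theorem isState_mix {n : Type*} [Fintype n] {ρ σ : Matrix n n ℂ} (hρ : IsState ρ) (hσ : IsState σ) {a b : ℝ} (ha : 0 ≤ a) (hb : 0 ≤ b)
    (hab : a + b = 1) : IsState (a • ρ + b • σ) := by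
  refine ⟨(hρ.1.smul ha).add (hσ.1.smul hb), ?_⟩
  rw [trace_add, trace_smul, trace_smul, hρ.2, hσ.2, ← add_smul, hab, one_smul]

/-- The excess over the average entropy is the Holevo quantity. Its nonnegativity is concavity, and
the domination `ρ ≤ a⁻¹ (a ρ + b σ)` bounds it by the mixing entropy. -/
theorem entropy_mix_eq (ρ σ : Matrix n n ℂ) (a b : ℝ) :
    entropy (a • ρ + b • σ) = a * entropy ρ + b * entropy σ +
      (a * relEntropy ρ (a • ρ + b • σ) + b * relEntropy σ (a • ρ + b • σ)) := by
  simp only [relEntropy]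
  conv_lhs => rw [entropy]
  rw [entropy, entropy, Matrix.add_mul, Matrix.smul_mul, Matrix.smul_mul, trace_add, trace_smul,
    trace_smul, Complex.add_re, Complex.smul_re, Complex.smul_re, smul_eq_mul, smul_eq_mul]
  ring

theorem posSemidef_inv_smul_mix_sub {n : Type*} {ρ σ : Matrix n n ℂ} (hσ : σ.PosSemidef) {a b : ℝ} (ha : 0 < a) (hb : 0 ≤ b) :
    (a⁻¹ • (a • ρ + b • σ) - ρ).PosSemidef := by
  have : a⁻¹ • (a • ρ + b • σ) - ρ = (a⁻¹ * b) • σ := by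
    rw [smul_add, smul_smul, inv_mul_cancel₀ ha.ne', one_smul, smul_smul, add_sub_cancel_left]
  rw [this]
  exact hσ.smul (mul_nonneg (inv_nonneg.mpr ha.le) hb)

theorem relEntropy_mix_bounds (hρ : IsState ρ) (hσ : IsState σ) {a b : ℝ} (ha : 0 < a)
    (hb : 0 < b) (hab : a + b = 1) :
    0 ≤ relEntropy ρ (a • ρ + b • σ) ∧ relEntropy ρ (a • ρ + b • σ) ≤ -Real.logb 2 a := by
  have h := posSemidef_inv_smul_mix_sub (ρ := ρ) hσ.1 ha hb.le
  refine ⟨relEntropy_nonneg hρ (isState_mix hρ hσ ha.le hb.le hab) h, ?_⟩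
  rw [← Real.logb_inv]
  exact relEntropy_le_logb hρ (inv_pos.mpr ha) h

/-- Concavity of the entropy. -/
theorem entropy_concave (hρ : IsState ρ) (hσ : IsState σ) {a b : ℝ} (ha : 0 < a)
    (hb : 0 < b) (hab : a + b = 1) :
    a * entropy ρ + b * entropy σ ≤ entropy (a • ρ + b • σ) := by
  have h1 := (relEntropy_mix_bounds hρ hσ ha hb hab).1
  have h2 := (relEntropy_mix_bounds hσ hρ hb ha (by linarith)).1
  rw [add_comm (b • σ)] at h2
  rw [entropy_mix_eq]
  have := mul_nonneg ha.le h1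
  have := mul_nonneg hb.le h2
  linarith

/-- The entropy of a mixture exceeds the average entropy at most by the mixing entropy. -/
theorem entropy_mix_le (hρ : IsState ρ) (hσ : IsState σ) {a b : ℝ} (ha : 0 < a)
    (hb : 0 < b) (hab : a + b = 1) :
    entropy (a • ρ + b • σ) ≤ a * entropy ρ + b * entropy σ + binaryEntropy b := by
  have h1 := (relEntropy_mix_bounds hρ hσ ha hb hab).2
  have h2 := (relEntropy_mix_bounds hσ hρ hb ha (by linarith)).2
  rw [add_comm (b • σ)] at h2
  rw [entropy_mix_eq, binaryEntropy, show 1 - b = a by linarith]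
  have := mul_le_mul_of_nonneg_left h1 ha.le
  have := mul_le_mul_of_nonneg_left h2 hb.le
  linarith

theorem entropy_nonneg (hρ : IsState ρ) : 0 ≤ entropy ρ := by
  obtain ⟨U, p, hU⟩ := exists_isDiagonalization hρ.1.isHermitian
  have hp := hU.posSemidef_iff.mp hρ.1
  have hp1 : ∑ i, p i = 1 := by
    have := hρ.2
    rw [hU.eq_coe_trace] at this
    exact_mod_cast this
  rw [hU.entropy_eq, ← Finset.sum_neg_distrib]
  refine Finset.sum_nonneg fun i _ => ?_
  have hle : p i ≤ 1 := by
    rw [← hp1]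
    exact Finset.single_le_sum (fun j _ => hp j) (Finset.mem_univ i)
  have := Real.logb_nonpos (b := 2) (by norm_num) (hp i) hle
  nlinarith [hp i]

theorem relEntropy_one (ρ : Matrix n n ℂ) : relEntropy ρ 1 = -entropy ρ := by
  have h : cfc (Real.logb 2) (1 : Matrix n n ℂ) = 0 := by
    rw [isDiagonalization_one.cfc_eq]
    simp
  rw [relEntropy, h, entropy]
  simp

theorem IsState.posSemidef_one_sub (hρ : IsState ρ) : (1 - ρ).PosSemidef := by
  obtain ⟨U, p, hU⟩ := exists_isDiagonalization hρ.1.isHermitian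
  have hp := hU.posSemidef_iff.mp hρ.1
  have hp1 : ∑ i, p i = 1 := by
    have := hρ.2
    rw [hU.eq_coe_trace] at this
    exact_mod_cast this
  have h : IsDiagonalization U (fun i => 1 - p i) (1 - ρ) := by
    refine ⟨hU.mul_conj, hU.conj_mul, ?_⟩
    have : diagonal (fun i => ((1 - p i : ℝ) : ℂ)) = 1 - diagonal (fun i => (p i : ℂ)) := by
      rw [← diagonal_one, diagonal_sub]
      simp
    rw [this, Matrix.mul_sub, Matrix.sub_mul, ← hU.eq, Matrix.mul_one, hU.mul_conj]
  refine h.posSemidef_iff.mpr fun i => sub_nonneg.mpr ?_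
  rw [← hp1]
  exact Finset.single_le_sum (fun j _ => hp j) (Finset.mem_univ i)

theorem IsState.card_pos {n : Type*} [Fintype n] {ρ : Matrix n n ℂ} (hρ : IsState ρ) : 0 < Fintype.card n := by
  rw [Fintype.card_pos_iff]
  by_contra h
  rw [not_nonempty_iff] at h
  have := hρ.2
  simp [Matrix.trace] at this

theorem entropy_le_logb_card (hρ : IsState ρ) : entropy ρ ≤ Real.logb 2 (Fintype.card n) := by
  have h : ((1 : ℝ) • (1 : Matrix n n ℂ) - ρ).PosSemidef := by
    rw [one_smul]
    exact hρ.posSemidef_one_sub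
  have := neg_logb_le_relEntropy hρ PosSemidef.one h (d := Fintype.card n)
    (by exact_mod_cast hρ.card_pos) (by simp)
  rw [relEntropy_one] at this
  linarith

end RelativeEntropyInequalities

/-! ### Partial traces and conditional entropy. -/

section Bipartite

variable {A B : Type*} [Fintype A] [Fintype B]

theorem reducedA_trace (ρ : Matrix (A × B) (A × B) ℂ) : (reducedA ρ).trace = ρ.trace := by
  simp [Matrix.trace, reducedA, Fintype.sum_prod_type]

theorem reducedB_trace (ρ : Matrix (A × B) (A × B) ℂ) : (reducedB ρ).trace = ρ.trace := by
  simp only [Matrix.trace, reducedB, Fintype.sum_prod_type, diag_apply, of_apply]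
  exact Finset.sum_comm

theorem IsState.reducedA {ρ : Matrix (A × B) (A × B) ℂ} (hρ : IsState ρ) :
    IsState (reducedA ρ) := by
  refine ⟨?_, (reducedA_trace ρ).trans hρ.2⟩
  have : QInfo.reducedA ρ = ∑ k : B, ρ.submatrix (fun i => (i, k)) (fun i => (i, k)) := by
    ext i j
    simp [QInfo.reducedA, Matrix.sum_apply]
  rw [this]
  exact posSemidef_sum _ fun k _ => hρ.1.submatrix _

theorem posSemidef_reducedB {A B : Type*} [Fintype A] {ρ : Matrix (A × B) (A × B) ℂ} (hρ : ρ.PosSemidef) :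
    (reducedB ρ).PosSemidef := by
  have : QInfo.reducedB ρ = ∑ k : A, ρ.submatrix (fun i => (k, i)) (fun i => (k, i)) := by
    ext i j
    simp [QInfo.reducedB, Matrix.sum_apply]
  rw [this]
  exact posSemidef_sum _ fun k _ => hρ.submatrix _

theorem IsState.reducedB {ρ : Matrix (A × B) (A × B) ℂ} (hρ : IsState ρ) :
    IsState (reducedB ρ) :=
  ⟨posSemidef_reducedB hρ.1, (reducedB_trace ρ).trans hρ.2⟩

theorem reducedA_mix {A B : Type*} [Fintype B] (ρ σ : Matrix (A × B) (A × B) ℂ) (a b : ℝ) :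
    reducedA (a • ρ + b • σ) = a • reducedA ρ + b • reducedA σ := by
  ext i j
  simp [reducedA, Finset.sum_add_distrib, Finset.mul_sum]

theorem reducedB_mix {A B : Type*} [Fintype A] (ρ σ : Matrix (A × B) (A × B) ℂ) (a b : ℝ) :
    reducedB (a • ρ + b • σ) = a • reducedB ρ + b • reducedB σ := by
  ext i j
  simp [reducedB, Finset.sum_add_distrib, Finset.mul_sum]

variable [DecidableEq A]

theorem trace_mul_one_kronecker (ρ : Matrix (A × B) (A × B) ℂ) (M : Matrix B B ℂ) :
    (ρ * ((1 : Matrix A A ℂ) ⊗ₖ M)).trace = (reducedB ρ * M).trace := by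
  simp only [Matrix.trace, diag_apply, mul_apply, reducedB, of_apply, Fintype.sum_prod_type,
    kronecker_apply, one_apply, ite_mul, one_mul, zero_mul, mul_ite, mul_zero]
  have : ∀ a b, ∑ a' : A, ∑ b' : B, (if a' = a then ρ (a, b) (a', b') * M b' b else 0) =
      ∑ b', ρ (a, b) (a, b') * M b' b := by
    intro a b
    rw [Finset.sum_comm]
    simp
  simp only [this, Finset.sum_mul]
  rw [Finset.sum_comm]
  exact Finset.sum_congr rfl fun b _ => Finset.sum_comm

/-- With `x = ∑ e_a ⊗ x_a`, the form of `1 ⊗ ρ_B` at `x` is the sum of the forms of `ρ` at all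
vectors `e_a' ⊗ x_a`. -/
theorem dotProduct_one_kronecker_reducedB (ρ : Matrix (A × B) (A × B) ℂ) (x : A × B → ℂ) :
    star x ⬝ᵥ (((1 : Matrix A A ℂ) ⊗ₖ reducedB ρ) *ᵥ x) =
      ∑ a, ∑ a', (star fun k : A × B => if k.1 = a' then x (a, k.2) else 0) ⬝ᵥ
        (ρ *ᵥ fun k => if k.1 = a' then x (a, k.2) else 0) := by
  have e1 : ∀ a a', (star fun k : A × B => if k.1 = a' then x (a, k.2) else 0) ⬝ᵥ
        (ρ *ᵥ fun k => if k.1 = a' then x (a, k.2) else 0) =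
      ∑ b, ∑ b', star (x (a, b)) * (ρ (a', b) (a', b') * x (a, b')) := by
    intro a a'
    simp only [dotProduct, mulVec, Pi.star_apply, Fintype.sum_prod_type, apply_ite star, star_zero,
      ite_mul, zero_mul, mul_ite, mul_zero]
    rw [Finset.sum_comm]
    refine Finset.sum_congr rfl fun b _ => ?_
    rw [Finset.sum_ite_eq' Finset.univ a']
    simp only [Finset.mem_univ, if_true]
    rw [Finset.sum_comm, Finset.mul_sum]
    refine Finset.sum_congr rfl fun b' _ => ?_
    rw [Finset.sum_ite_eq' Finset.univ a']
    simp
  simp only [e1]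
  simp only [dotProduct, mulVec, Pi.star_apply, Fintype.sum_prod_type, kronecker_apply, one_apply,
    ite_mul, one_mul, zero_mul, reducedB, of_apply]
  refine Finset.sum_congr rfl fun a _ => ?_
  rw [Finset.sum_comm (γ := A)]
  refine Finset.sum_congr rfl fun b _ => ?_
  rw [Finset.sum_comm (γ := A), Finset.sum_comm (γ := A), Finset.mul_sum]
  refine Finset.sum_congr rfl fun b' _ => ?_
  rw [Finset.sum_ite_eq Finset.univ a]
  simp only [Finset.mem_univ, if_true, Finset.sum_mul, Finset.mul_sum]

/-- The operator inequality `ρ ≤ d_A (1 ⊗ ρ_B)`. -/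
theorem posSemidef_card_smul_sub {ρ : Matrix (A × B) (A × B) ℂ} (hρ : ρ.PosSemidef) :
    ((Fintype.card A : ℝ) • ((1 : Matrix A A ℂ) ⊗ₖ reducedB ρ) - ρ).PosSemidef := by
  classical
  have hk : ((1 : Matrix A A ℂ) ⊗ₖ reducedB ρ).PosSemidef :=
    PosSemidef.one.kronecker (posSemidef_reducedB hρ)
  refine PosSemidef.of_dotProduct_mulVec_nonneg
    ((hk.smul (Nat.cast_nonneg (α := ℝ) _)).isHermitian.sub hρ.isHermitian) fun x => ?_
  -- Here `v a a'` is `e_a' ⊗ x_a`, so `x` is the sum of the diagonal `v a a`.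
  set v : A → A → A × B → ℂ := fun a a' k => if k.1 = a' then x (a, k.2) else 0 with hv
  have hx : x = ∑ a, v a a := by
    ext k
    simp [hv]
  set G : A → A → ℂ := fun a a' => star (v a a) ⬝ᵥ (ρ *ᵥ v a' a') with hG
  have e1 : star x ⬝ᵥ (ρ *ᵥ x) = ∑ a, ∑ a', G a a' := by
    conv_lhs => rw [hx]
    simp only [star_sum, mulVec_sum, sum_dotProduct, dotProduct_sum, hG]
    exact Finset.sum_comm
  have e2 := dotProduct_one_kronecker_reducedB ρ x
  have h1 : ∑ a, G a a ≤ star x ⬝ᵥ (((1 : Matrix A A ℂ) ⊗ₖ reducedB ρ) *ᵥ x) := by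
    rw [e2]
    refine Finset.sum_le_sum fun a _ => ?_
    exact Finset.single_le_sum (f := fun a' => star (v a a') ⬝ᵥ (ρ *ᵥ v a a'))
      (fun a' _ => hρ.dotProduct_mulVec_nonneg _) (Finset.mem_univ a)
  -- Positivity of `ρ` on the differences `v a a - v a' a'` gives the Cauchy-Schwarz bound `∑∑ G a
  -- a' ≤ d_A ∑ G a a`.
  have h2 : 0 ≤ ∑ a, ∑ a', (G a a - G a a' - G a' a + G a' a') := by
    refine Finset.sum_nonneg fun a _ => Finset.sum_nonneg fun a' _ => ?_
    have := hρ.dotProduct_mulVec_nonneg (v a a - v a' a')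
    rw [star_sub, mulVec_sub, dotProduct_sub, sub_dotProduct, sub_dotProduct] at this
    convert this using 1
    simp only [hG]
    ring
  have e3 : ∑ a, ∑ a', (G a a - G a a' - G a' a + G a' a') =
      2 * ((Fintype.card A : ℂ) * ∑ a, G a a - ∑ a, ∑ a', G a a') := by
    simp only [Finset.sum_add_distrib, Finset.sum_sub_distrib, Finset.sum_const, Finset.card_univ,
      nsmul_eq_mul, ← Finset.mul_sum]
    rw [Finset.sum_comm (f := fun a a' => G a' a)]
    ring
  rw [e3] at h2
  have h3 : 0 ≤ (Fintype.card A : ℂ) * ∑ a, G a a - ∑ a, ∑ a', G a a' := by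
    have := mul_nonneg (show (0 : ℂ) ≤ 1 / 2 by rw [Complex.le_def]; norm_num) h2
    rwa [← mul_assoc, one_div, inv_mul_cancel₀ two_ne_zero, one_mul] at this
  rw [sub_mulVec, dotProduct_sub, smul_mulVec, dotProduct_smul, e1, Complex.real_smul,
    Complex.ofReal_natCast]
  have h4 := mul_le_mul_of_nonneg_left h1 (Nat.cast_nonneg (α := ℂ) (Fintype.card A))
  exact h3.trans (sub_le_sub_right h4 _)

variable [DecidableEq B]

theorem cfc_one_kronecker {M : Matrix B B ℂ} (hM : M.IsHermitian) (f : ℝ → ℝ) :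
    cfc f ((1 : Matrix A A ℂ) ⊗ₖ M) = (1 : Matrix A A ℂ) ⊗ₖ cfc f M := by
  obtain ⟨U, p, hU⟩ := exists_isDiagonalization hM
  rw [(isDiagonalization_one.kronecker hU).cfc_eq f,
    (isDiagonalization_one.kronecker (hU.cfc f)).eq]
  simp

/-- The conditional entropy `S(A|B) = S(AB) - S(B)`. -/
def condEntropy (ρ : Matrix (A × B) (A × B) ℂ) : ℝ := entropy ρ - entropy (reducedB ρ)

theorem condEntropy_eq {ρ : Matrix (A × B) (A × B) ℂ} (hρ : ρ.PosSemidef) :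
    condEntropy ρ = -relEntropy ρ ((1 : Matrix A A ℂ) ⊗ₖ reducedB ρ) := by
  rw [relEntropy, cfc_one_kronecker (posSemidef_reducedB hρ).isHermitian,
    trace_mul_one_kronecker, condEntropy, entropy, entropy]
  ring

/-- Joint convexity of `D(ρ‖1 ⊗ ρ_B)`, whose second argument is linear in `ρ`; `ρ ≤ d_A (1 ⊗ ρ_B)`
supplies the support condition. -/
theorem condEntropy_concave {ρ σ : Matrix (A × B) (A × B) ℂ} (hρ : IsState ρ) (hσ : IsState σ)
    {a b : ℝ} (ha : 0 < a) (hb : 0 < b) (hab : a + b = 1) :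
    a * condEntropy ρ + b * condEntropy σ ≤ condEntropy (a • ρ + b • σ) := by
  have h := relEntropy_smul_add_le hρ.1 hσ.1
    (PosSemidef.one.kronecker (posSemidef_reducedB hρ.1))
    (PosSemidef.one.kronecker (posSemidef_reducedB hσ.1))
    (posSemidef_card_smul_sub hρ.1) (posSemidef_card_smul_sub hσ.1) ha.le hb.le
  rw [condEntropy_eq hρ.1, condEntropy_eq hσ.1,
    condEntropy_eq (isState_mix hρ hσ ha.le hb.le hab).1, reducedB_mix, kronecker_add,
    kronecker_smul, kronecker_smul]
  linarith

/-- Only `S(AB)` costs a mixing entropy; `-S(B)` is already convex. -/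
theorem condEntropy_mix_le {ρ σ : Matrix (A × B) (A × B) ℂ} (hρ : IsState ρ) (hσ : IsState σ)
    {a b : ℝ} (ha : 0 < a) (hb : 0 < b) (hab : a + b = 1) :
    condEntropy (a • ρ + b • σ) ≤ a * condEntropy ρ + b * condEntropy σ + binaryEntropy b := by
  have h1 := entropy_mix_le hρ hσ ha hb hab
  have h2 := entropy_concave hρ.reducedB hσ.reducedB ha hb hab
  rw [condEntropy, condEntropy, condEntropy, reducedB_mix]
  linarith

theorem card_pos_of_isState {A B : Type*} [Fintype A] [Fintype B] {ρ : Matrix (A × B) (A × B) ℂ} (hρ : IsState ρ) :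
    0 < Fintype.card A :=
  hρ.reducedA.card_pos

theorem neg_logb_card_le_condEntropy {ρ : Matrix (A × B) (A × B) ℂ} (hρ : IsState ρ) :
    -Real.logb 2 (Fintype.card A) ≤ condEntropy ρ := by
  rw [condEntropy_eq hρ.1]
  exact neg_le_neg (relEntropy_le_logb hρ (by exact_mod_cast card_pos_of_isState hρ)
    (posSemidef_card_smul_sub hρ.1))

theorem condEntropy_le_logb_card {ρ : Matrix (A × B) (A × B) ℂ} (hρ : IsState ρ) :
    condEntropy ρ ≤ Real.logb 2 (Fintype.card A) := by
  rw [condEntropy_eq hρ.1]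
  have := neg_logb_le_relEntropy hρ (PosSemidef.one.kronecker (posSemidef_reducedB hρ.1))
    (posSemidef_card_smul_sub hρ.1) (d := Fintype.card A)
    (by exact_mod_cast card_pos_of_isState hρ)
    (by rw [trace_kronecker, hρ.reducedB.2]; simp)
  linarith

theorem mutualInfo_eq (ρ : Matrix (A × B) (A × B) ℂ) :
    mutualInfo ρ = entropy (reducedA ρ) - condEntropy ρ := by
  rw [mutualInfo, condEntropy]
  ring

end Bipartite

/-! ### The Alicki-Fannes-Winter continuity argument. -/

section Continuity

variable {n : Type*} [Fintype n] [DecidableEq n] {ρ σ : Matrix n n ℂ}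

theorem traceNorm_nonneg (hρ : ρ.IsHermitian) : 0 ≤ traceNorm ρ := by
  obtain ⟨U, p, hU⟩ := exists_isDiagonalization hρ
  rw [hU.traceNorm_eq]
  exact Finset.sum_nonneg fun i _ => abs_nonneg _

theorem eq_zero_of_traceNorm_eq_zero (hρ : ρ.IsHermitian) (h : traceNorm ρ = 0) : ρ = 0 := by
  obtain ⟨U, p, hU⟩ := exists_isDiagonalization hρ
  rw [hU.traceNorm_eq, Finset.sum_eq_zero_iff_of_nonneg fun i _ => abs_nonneg _] at h
  have hp : (fun i => (p i : ℂ)) = fun _ => 0 := by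
    funext i
    simpa using h i (Finset.mem_univ i)
  rw [hU.eq, hp]
  simp

/-- The Jordan decomposition of a difference of states. -/
theorem exists_add_smul_eq (hρ : IsState ρ) (hσ : IsState σ) {ε : ℝ} (hε : 0 < ε)
    (h : traceNorm (ρ - σ) = 2 * ε) :
    ∃ P N, IsState P ∧ IsState N ∧ ρ + ε • N = σ + ε • P := by
  obtain ⟨U, p, hU⟩ := exists_isDiagonalization (hρ.1.isHermitian.sub hσ.1.isHermitian)
  rw [hU.traceNorm_eq] at h
  have h0 : ∑ i, p i = 0 := by
    have := hU.eq_coe_trace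
    rw [trace_sub, hρ.2, hσ.2, sub_self] at this
    exact_mod_cast this.symm
  have key : ∀ f : ℝ → ℝ, (∀ x, 0 ≤ f x) → ∑ i, f (p i) = ε →
      IsState (ε⁻¹ • cfc f (ρ - σ)) := by
    intro f hf hs
    refine ⟨((hU.cfc f).posSemidef_iff.mpr fun i => hf _).smul (inv_nonneg.mpr hε.le), ?_⟩
    rw [trace_smul, (hU.cfc f).eq_coe_trace, hs, Complex.real_smul, ← Complex.ofReal_mul,
      inv_mul_cancel₀ hε.ne', Complex.ofReal_one]
  -- `P` and `N` are the normalized positive and negative parts of `ρ - σ`; since its trace is zero,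
  -- both parts have trace `ε`.
  refine ⟨_, _, key (fun x => (|x| + x) / 2) (fun x => ?_) ?_,
    key (fun x => (|x| - x) / 2) (fun x => ?_) ?_, ?_⟩
  · linarith [neg_abs_le x]
  · rw [← Finset.sum_div, Finset.sum_add_distrib, h, h0]
    ring
  · linarith [le_abs_self x]
  · rw [← Finset.sum_div, Finset.sum_sub_distrib, h, h0]
    ring
  · rw [smul_smul, smul_smul, mul_inv_cancel₀ hε.ne', one_smul, one_smul]
    have : ρ - σ = cfc (fun x : ℝ => (|x| + x) / 2) (ρ - σ) -
        cfc (fun x : ℝ => (|x| - x) / 2) (ρ - σ) := by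
      rw [hU.cfc_eq, hU.cfc_eq, ← Matrix.sub_mul, ← Matrix.mul_sub, diagonal_sub]
      conv_lhs => rw [hU.eq]
      congr 3
      funext i
      push_cast
      ring
    rw [add_comm σ, ← sub_eq_sub_iff_add_eq_add]
    exact this

/-- The Alicki-Fannes-Winter argument: a functional on states that is concave, and convex up to
the mixing entropy, is uniformly continuous with constants depending only on its range. -/
theorem sub_le_of_almost_affine {F : Matrix n n ℂ → ℝ} {m M : ℝ}
    (hconcave : ∀ ρ σ, IsState ρ → IsState σ → ∀ a b : ℝ, 0 < a → 0 < b → a + b = 1 →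
      a * F ρ + b * F σ ≤ F (a • ρ + b • σ))
    (hmix : ∀ ρ σ, IsState ρ → IsState σ → ∀ a b : ℝ, 0 < a → 0 < b → a + b = 1 →
      F (a • ρ + b • σ) ≤ a * F ρ + b * F σ + binaryEntropy b)
    (hm : ∀ ρ, IsState ρ → m ≤ F ρ) (hM : ∀ ρ, IsState ρ → F ρ ≤ M)
    (hρ : IsState ρ) (hσ : IsState σ) {ε : ℝ} (hε : 0 < ε) (h : traceNorm (ρ - σ) = 2 * ε) :
    |F ρ - F σ| ≤ ε * (M - m) + (1 + ε) * binaryEntropy (ε / (1 + ε)) := by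
  obtain ⟨P, N, hP, hN, hPN⟩ := exists_add_smul_eq hρ hσ hε h
  have h1 : 0 < 1 + ε := by linarith
  have key : ∀ ρ σ P N : Matrix n n ℂ, IsState ρ → IsState σ → IsState P → IsState N →
      ρ + ε • N = σ + ε • P →
      F ρ - F σ ≤ ε * (M - m) + (1 + ε) * binaryEntropy (ε / (1 + ε)) := by
    intro ρ σ P N hρ hσ hP hN hPN
    have hab : (1 + ε)⁻¹ + ε / (1 + ε) = 1 := by field_simp
    -- One state, two mixtures: concavity is applied to the left one and the mixing bound to the
    -- right one.
    have e : (1 + ε)⁻¹ • ρ + (ε / (1 + ε)) • N = (1 + ε)⁻¹ • σ + (ε / (1 + ε)) • P := by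
      have := congrArg ((1 + ε)⁻¹ • ·) hPN
      simpa only [smul_add, smul_smul, div_eq_inv_mul] using this
    have i1 := hconcave ρ N hρ hN _ _ (inv_pos.mpr h1) (div_pos hε h1) hab
    have i2 := hmix σ P hσ hP _ _ (inv_pos.mpr h1) (div_pos hε h1) hab
    rw [e] at i1
    have i3 := mul_le_mul_of_nonneg_left (i1.trans i2) h1.le
    have e1 : (1 + ε) * ((1 + ε)⁻¹ * F ρ + ε / (1 + ε) * F N) = F ρ + ε * F N := by field_simp
    have e2 : (1 + ε) * ((1 + ε)⁻¹ * F σ + ε / (1 + ε) * F P + binaryEntropy (ε / (1 + ε))) =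
        F σ + ε * F P + (1 + ε) * binaryEntropy (ε / (1 + ε)) := by field_simp
    rw [e1, e2] at i3
    have i4 := mul_le_mul_of_nonneg_left (hm N hN) hε.le
    have i5 := mul_le_mul_of_nonneg_left (hM P hP) hε.le
    linarith
  exact abs_sub_le_iff.mpr ⟨key ρ σ P N hρ hσ hP hN hPN, key σ ρ N P hσ hρ hN hP hPN.symm⟩

theorem binaryEntropy_nonneg {x : ℝ} (h0 : 0 ≤ x) (h1 : x ≤ 1) : 0 ≤ binaryEntropy x := by
  have i1 := mul_nonneg h0 (neg_nonneg.mpr (Real.logb_nonpos (b := 2) (by norm_num) h0 h1))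
  have i2 := mul_nonneg (sub_nonneg.mpr h1) (neg_nonneg.mpr
    (Real.logb_nonpos (b := 2) (by norm_num) (sub_nonneg.mpr h1) (by linarith)))
  rw [binaryEntropy]
  linarith

theorem binaryEntropy_mul_log (x : ℝ) :
    binaryEntropy x * Real.log 2 = -x * Real.log x - (1 - x) * Real.log (1 - x) := by
  have : Real.log 2 ≠ 0 := (Real.log_pos (by norm_num)).ne'
  simp only [binaryEntropy, Real.logb]
  field_simp

/-- In natural logarithms, `(1 + ε) h_b(ε/(1 + ε))` is `(1 + ε) log (1 + ε) - ε log ε`, while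
`h_b(2ε) ≥ -2ε log (2ε)`. With `log ε ≤ -log 2` the remaining linear terms reduce to `3 ≤ 7 log 2`,
and `L ≥ 1` is what lets `ε L` absorb them. -/
theorem binaryEntropy_bound {ε L : ℝ} (hε : 0 < ε) (hε' : ε < 1 / 2) (hL : 1 ≤ L) :
    3 * ε * L + 2 * ((1 + ε) * binaryEntropy (ε / (1 + ε))) ≤
      12 * ε * L + 4 * binaryEntropy (2 * ε) := by
  have hlog : 0 < Real.log 2 := Real.log_pos (by norm_num)
  have h1 : 0 < 1 + ε := by linarith
  have e1 : (1 + ε) * (binaryEntropy (ε / (1 + ε)) * Real.log 2) =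
      (1 + ε) * Real.log (1 + ε) - ε * Real.log ε := by
    rw [binaryEntropy_mul_log, show 1 - ε / (1 + ε) = (1 + ε)⁻¹ by field_simp; ring, Real.log_inv,
      Real.log_div hε.ne' h1.ne']
    field_simp
    ring
  have e2 : -(2 * ε) * (Real.log 2 + Real.log ε) ≤ binaryEntropy (2 * ε) * Real.log 2 := by
    rw [binaryEntropy_mul_log, Real.log_mul two_ne_zero hε.ne']
    have := Real.log_nonpos (x := 1 - 2 * ε) (by linarith) (by linarith)
    nlinarith
  have e3 : Real.log (1 + ε) ≤ ε := by linarith [Real.log_le_sub_one_of_pos h1]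
  have e4 : Real.log ε ≤ -Real.log 2 := by
    rw [← Real.log_inv]
    exact Real.log_le_log hε (by linarith)
  have e5 : 0.69 < Real.log 2 := by linarith [Real.log_two_gt_d9]
  have e6 : (1 + ε) * Real.log (1 + ε) ≤ (3 / 2) * ε := by nlinarith
  have e7 : ε * Real.log ε ≤ -(ε * Real.log 2) := by nlinarith
  have e8 : ε * 0.69 ≤ ε * Real.log 2 := by nlinarith
  have e9 : ε * Real.log 2 ≤ ε * L * Real.log 2 := by nlinarith [mul_pos hε hlog]
  refine le_of_mul_le_mul_right ?_ hlog
  nlinarith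

end Continuity

/-! ### Continuity of mutual information, and product states. -/

section MutualInformation

variable {A B : Type*} [Fintype A] [DecidableEq A] [Fintype B] [DecidableEq B]
  {ρ σ : Matrix (A × B) (A × B) ℂ}

theorem abs_mutualInfo_sub_le (hρ : IsState ρ) (hσ : IsState σ) {δ : ℝ}
    (hδ : δ = traceNorm (ρ - σ)) (hδ1 : δ < 1) :
    |mutualInfo ρ - mutualInfo σ| ≤
      6 * δ * Real.logb 2 (Fintype.card A) + 4 * binaryEntropy δ := by
  have hδ0 : 0 ≤ δ := hδ ▸ traceNorm_nonneg (hρ.1.isHermitian.sub hσ.1.isHermitian)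
  have hb := binaryEntropy_nonneg hδ0 hδ1.le
  have hsplit : |mutualInfo ρ - mutualInfo σ| ≤
      |entropy (reducedA ρ) - entropy (reducedA σ)| + |condEntropy ρ - condEntropy σ| := by
    rw [mutualInfo_eq, mutualInfo_eq]
    rw [sub_sub_sub_comm]
    exact abs_sub _ _
  rcases hδ0.eq_or_lt with h0 | h0
  -- The case `δ = 0` is separate because the Jordan parts are normalized by `ε⁻¹`.
  · have : ρ = σ := sub_eq_zero.mp (eq_zero_of_traceNorm_eq_zero
      (hρ.1.isHermitian.sub hσ.1.isHermitian) (by rw [← hδ, ← h0]))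
    rw [this, sub_self, abs_zero, ← h0]
    rw [← h0] at hb
    linarith
  refine hsplit.trans ?_
  have hcard := card_pos_of_isState hρ
  rcases (Nat.succ_le_of_lt hcard).eq_or_lt with h1 | h1
  -- For `d_A = 1` the numerical bound is unavailable, but both functionals have range `{0}`.
  · have hL : Real.logb 2 (Fintype.card A) = 0 := by simp [← h1]
    have a1 := entropy_nonneg hρ.reducedA
    have a2 := entropy_nonneg hσ.reducedA
    have a3 := entropy_le_logb_card hρ.reducedA
    have a4 := entropy_le_logb_card hσ.reducedA
    have a5 := neg_logb_card_le_condEntropy hρ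
    have a6 := neg_logb_card_le_condEntropy hσ
    have a7 := condEntropy_le_logb_card hρ
    have a8 := condEntropy_le_logb_card hσ
    rw [hL] at *
    have b1 : entropy (reducedA ρ) - entropy (reducedA σ) = 0 := by linarith
    have b2 : condEntropy ρ - condEntropy σ = 0 := by linarith
    rw [b1, b2, abs_zero]
    linarith
  · have hL : 1 ≤ Real.logb 2 (Fintype.card A) := by
      rw [Real.le_logb_iff_rpow_le (by norm_num) (by exact_mod_cast hcard), Real.rpow_one]
      exact_mod_cast h1
    have hε : 0 < δ / 2 := by linarith
    have hn : traceNorm (ρ - σ) = 2 * (δ / 2) := by rw [← hδ]; ring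
    have i1 := sub_le_of_almost_affine (F := fun ρ : Matrix (A × B) (A × B) ℂ =>
        entropy (reducedA ρ)) (m := 0) (M := Real.logb 2 (Fintype.card A))
      (fun ρ σ hρ hσ a b ha hb hab => by
        rw [reducedA_mix]; exact entropy_concave hρ.reducedA hσ.reducedA ha hb hab)
      (fun ρ σ hρ hσ a b ha hb hab => by
        rw [reducedA_mix]; exact entropy_mix_le hρ.reducedA hσ.reducedA ha hb hab)
      (fun ρ hρ => entropy_nonneg hρ.reducedA) (fun ρ hρ => entropy_le_logb_card hρ.reducedA)
      hρ hσ hε hn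
    have i2 := sub_le_of_almost_affine (F := condEntropy (A := A) (B := B))
      (m := -Real.logb 2 (Fintype.card A)) (M := Real.logb 2 (Fintype.card A))
      (fun ρ σ hρ hσ a b ha hb hab => condEntropy_concave hρ hσ ha hb hab)
      (fun ρ σ hρ hσ a b ha hb hab => condEntropy_mix_le hρ hσ ha hb hab)
      (fun ρ hρ => neg_logb_card_le_condEntropy hρ) (fun ρ hρ => condEntropy_le_logb_card hρ)
      hρ hσ hε hn
    have i3 := binaryEntropy_bound hε (by linarith) hL
    rw [show 2 * (δ / 2) = δ by ring] at i3
    linarith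

theorem isState_kronecker {A B : Type*} [Fintype A] [Fintype B] {a : Matrix A A ℂ} {b : Matrix B B ℂ} (ha : IsState a)
    (hb : IsState b) : IsState (a ⊗ₖ b) :=
  ⟨ha.1.kronecker hb.1, by rw [trace_kronecker, ha.2, hb.2, one_mul]⟩

theorem entropy_kronecker {a : Matrix A A ℂ} {b : Matrix B B ℂ} (ha : IsState a)
    (hb : IsState b) : entropy (a ⊗ₖ b) = entropy a + entropy b := by
  obtain ⟨U, p, hU⟩ := exists_isDiagonalization ha.1.isHermitian
  obtain ⟨V, q, hV⟩ := exists_isDiagonalization hb.1.isHermitian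
  have hp1 : ∑ i, p i = 1 := by
    have := ha.2
    rw [hU.eq_coe_trace] at this
    exact_mod_cast this
  have hq1 : ∑ i, q i = 1 := by
    have := hb.2
    rw [hV.eq_coe_trace] at this
    exact_mod_cast this
  have key : ∀ i j, p i * q j * Real.logb 2 (p i * q j) =
      (p i * Real.logb 2 (p i)) * q j + p i * (q j * Real.logb 2 (q j)) := by
    intro i j
    by_cases hi : p i = 0
    · simp [hi]
    by_cases hj : q j = 0
    · simp [hj]
    rw [Real.logb_mul hi hj]
    ring
  rw [(hU.kronecker hV).entropy_eq, hU.entropy_eq, hV.entropy_eq, Fintype.sum_prod_type]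
  simp only [key, Finset.sum_add_distrib, ← Finset.mul_sum, hq1, ← Finset.sum_mul, hp1]
  ring

theorem isState_productOfReduced {A B : Type*} [Fintype A] [Fintype B]
    {ρ : Matrix (A × B) (A × B) ℂ} (hρ : IsState ρ) : IsState (productOfReduced ρ) :=
  isState_kronecker hρ.reducedA hρ.reducedB

theorem mutualInfo_productOfReduced (hρ : IsState ρ) : mutualInfo (productOfReduced ρ) = 0 := by
  rw [mutualInfo, productOfReduced, reducedA_kronecker, reducedB_kronecker, hρ.reducedA.2,
    hρ.reducedB.2, one_smul, one_smul, entropy_kronecker hρ.reducedA hρ.reducedB, sub_self]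

end MutualInformation

end QInfo

end

theorem mainTheorem5 {A B : Type*} [Fintype A] [DecidableEq A] [Fintype B] [DecidableEq B]
    (ρ : Matrix (A × B) (A × B) ℂ) (hρ : QInfo.IsState ρ) :
    (∀ (σ : Matrix (A × B) (A × B) ℂ) (δ : ℝ), QInfo.IsState σ →
      δ = QInfo.traceNorm (ρ - σ) → δ < 1 →
      |QInfo.mutualInfo ρ - QInfo.mutualInfo σ| ≤
        6 * δ * Real.logb 2 (Fintype.card A) + 4 * QInfo.binaryEntropy δ) ∧
    QInfo.IsState (QInfo.productOfReduced ρ) ∧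
    QInfo.mutualInfo (QInfo.productOfReduced ρ) = 0 ∧
    (QInfo.traceDistCorr ρ < 1 →
      QInfo.mutualInfo ρ ≤
        6 * QInfo.traceDistCorr ρ * Real.logb 2 (Fintype.card A) +
          4 * QInfo.binaryEntropy (QInfo.traceDistCorr ρ)) := by
  have hI := QInfo.mutualInfo_productOfReduced hρ
  have hS := QInfo.isState_productOfReduced hρ
  refine ⟨fun σ δ hσ hδ hδ1 => QInfo.abs_mutualInfo_sub_le hρ hσ hδ hδ1, hS, hI, fun hT => ?_⟩
  have h := QInfo.abs_mutualInfo_sub_le hρ hS rfl hT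
  rw [hI, sub_zero] at h
  exact (le_abs_self _).trans h
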